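/- Let $\mathscr A=\{A_1,\dots,A_r\}$ be a finite set of real $m\times m$ matrices, not all of them zero, that is irreducible: the matrices $A_i$ have no common invariant subspaces except $\{0\}$ and $\mathbb R^m$. Let $\|\cdot\|_0$ be a norm on $\mathbb R^m$, let $e\in\mathbb R^m$ satisfy $\|e\|_0=1$, let $0<\lambda^-\le\lambda^+<1$, and let $\lambda_n\in[\lambda^-,\lambda^+]$ $(n\ge 0)$ be arbitrary. Define recursively, for $n=0,1,2,\dots$, $$\rho_n^+=\max_{x\ne0}\frac{\max_i\|A_ix\|_n}{\|x\|_n},\qquad \rho_n^-=\min_{x\ne0}\frac{\max_i\|A_ix\|_n}{\|x\|_n},\qquad \gamma_n=\max_i\|A_ie\|_n,$$ $$\|x\|_{n+1}=\lambda_n\|x\|_n+(1-\lambda_n)\gamma_n^{-1}\max_i\|A_ix\|_n .$$ Let $\rho=\rho(\mathscr A)$ be the joint spectral radius of $\mathscr A$, that is, $$\rho(\mathscr A)=\limsup_{k\to\infty}\Bigl(\max_{1\le i_1,\dots,i_k\le r}\|A_{i_k}\cdots A_{i_1}\|\Bigr)^{1/k},$$ where $\|M\|=\sup_{\|x\|=1}\|Mx\|$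 is the matrix norm generated by any norm $\|\cdot\|$ on $\mathbb R^m$. Then the procedure is well defined (every $\|\cdot\|_n$ is a norm, $\gamma_n>0$, and the maximum and the minimum above are attained), and: 1. the sequences $\{\rho_n^+\}$ and $\{\rho_n^-\}$ converge, and $\lim_{n\to\infty}\rho_n^+=\lim_{n\to\infty}\rho_n^-=\rho$, whichever norm is used to compute $\rho$; 2. there is a norm $\|\cdot\|^*$ on $\mathbb R^m$ with $\rho\|x\|^*=\max_i\|A_ix\|^*$ for all $x\in\mathbb R^m$ (a Barabanov norm of $\mathscr A$) such that $\|\cdot\|_n\to\|\cdot\|^*$ as $n\to\infty$ uniformly on every bounded subset of $\mathbb R^m$. -/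

import Mathlib

open Filter Topology

namespace LinearRelaxation

variable {m r : ℕ}

/-- `N` is a norm on the real vector space `ℝ^m`. -/
structure IsNorm (N : (Fin m → ℝ) → ℝ) : Prop where
  eq_zero_iff : ∀ x, N x = 0 ↔ x = 0
  smul : ∀ (c : ℝ) (x), N (c • x) = |c| * N x
  add_le : ∀ x y, N (x + y) ≤ N x + N y

/-- The matrices `A 0, …, A (r-1)` have no common invariant subspaces except `{0}` and `ℝ^m`. -/
def IsIrreducible (A : Fin r → Matrix (Fin m) (Fin m) ℝ) : Prop :=
  ∀ V : Submodule ℝ (Fin m → ℝ), (∀ i, ∀ x ∈ V, (A i).mulVec x ∈ V) → V = ⊥ ∨ V = ⊤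

/-- `‖M‖ = sup_{‖x‖ = 1} ‖M x‖`, the matrix norm generated by the vector norm `N`. -/
noncomputable def opNorm (N : (Fin m → ℝ) → ℝ) (M : Matrix (Fin m) (Fin m) ℝ) : ℝ :=
  sSup {t : ℝ | ∃ x, N x = 1 ∧ t = N (M.mulVec x)}

/-- The maximum of the norms of all products of `k` matrices of the family `A`. -/
noncomputable def maxProdNorm (N : (Fin m → ℝ) → ℝ) (A : Fin r → Matrix (Fin m) (Fin m) ℝ)
    (k : ℕ) : ℝ :=
  ⨆ w : Fin k → Fin r, opNorm N (List.ofFn fun j => A (w j)).prod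

/-- The joint spectral radius of the family `A`, computed by means of the vector norm `N`. -/
noncomputable def jointSpectralRadius (N : (Fin m → ℝ) → ℝ)
    (A : Fin r → Matrix (Fin m) (Fin m) ℝ) : ℝ :=
  limsup (fun k : ℕ => maxProdNorm N A k ^ (1 / (k : ℝ))) atTop

/-- `max_i ‖A_i x‖`. -/
noncomputable def maxImage (A : Fin r → Matrix (Fin m) (Fin m) ℝ) (N : (Fin m → ℝ) → ℝ)
    (x : Fin m → ℝ) : ℝ :=
  ⨆ i, N ((A i).mulVec x)

/-- `N` is a norm with `ρ ‖x‖ = max_i ‖A_i x‖` for all `x`. -/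
def IsBarabanovNorm (A : Fin r → Matrix (Fin m) (Fin m) ℝ) (ρ : ℝ)
    (N : (Fin m → ℝ) → ℝ) : Prop :=
  IsNorm N ∧ ∀ x, ρ * N x = maxImage A N x

/-- The set of the values `max_i ‖A_i x‖ / ‖x‖`, `x ≠ 0`. -/
def growthRatios (A : Fin r → Matrix (Fin m) (Fin m) ℝ) (N : (Fin m → ℝ) → ℝ) : Set ℝ :=
  {t | ∃ x, x ≠ 0 ∧ t = maxImage A N x / N x}

/-- The functions `‖·‖_n` of the linear relaxation procedure with initial norm `N₀`, calibrating
vector `e` and parameters `lam n`; here `γ_n = max_i ‖A_i e‖_n`. -/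
noncomputable def lrNorm (A : Fin r → Matrix (Fin m) (Fin m) ℝ) (N₀ : (Fin m → ℝ) → ℝ)
    (e : Fin m → ℝ) (lam : ℕ → ℝ) : ℕ → (Fin m → ℝ) → ℝ
  | 0 => N₀
  | n + 1 => fun x =>
      lam n * lrNorm A N₀ e lam n x
        + (1 - lam n) * (maxImage A (lrNorm A N₀ e lam n) e)⁻¹
            * maxImage A (lrNorm A N₀ e lam n) x

/-- `ρ⁺_n = max_{x ≠ 0} max_i ‖A_i x‖_n / ‖x‖_n`. -/
noncomputable def rhoPlus (A : Fin r → Matrix (Fin m) (Fin m) ℝ) (N₀ : (Fin m → ℝ) → ℝ)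
    (e : Fin m → ℝ) (lam : ℕ → ℝ) (n : ℕ) : ℝ :=
  sSup (growthRatios A (lrNorm A N₀ e lam n))

/-- `ρ⁻_n = min_{x ≠ 0} max_i ‖A_i x‖_n / ‖x‖_n`. -/
noncomputable def rhoMinus (A : Fin r → Matrix (Fin m) (Fin m) ℝ) (N₀ : (Fin m → ℝ) → ℝ)
    (e : Fin m → ℝ) (lam : ℕ → ℝ) (n : ℕ) : ℝ :=
  sInf (growthRatios A (lrNorm A N₀ e lam n))

end LinearRelaxation

/-! Calibrated by `‖e‖_n = 1`, all the norms `‖·‖_n` lie in one class, `Admissible`, with growth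
bound `R = ρ_0^+`. Irreducibility makes this class compact: the vectors at which it is bounded, and
the kernel of any member, are invariant subspaces, the first containing `e` and the second not. A
relaxation step never raises `ρ_n^+` nor lowers `ρ_n^-`, so they converge, to `p` and `q` say.

To see `p = q`, take ultrafilter limits `M j` of the shifted sequences `‖·‖_{n-j}`. They form a
backward orbit along which both extreme rates stay equal to `p` and `q`, attained at fixed vectors
`x` and `y`. If `q < p`, each step forward multiplies `M j x / M j y` by at least a fixed factor
above 1, which compactness forbids (`growth_rates_eq_of_backward_orbit`). Hence `M 0` is a Barabanov
norm (`exists_limit_of_lrNorm`).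

Steps do not increase eccentricity relative to that norm (`lrNorm_eccentricity_le`), so closeness at
one time persists and the whole sequence converges. Products of length `k` stretch a Barabanov norm
by at most `p ^ k`, with equality for some product at each vector; equivalence of norms then gives
`ρ = p` (`IsBarabanovNorm.jointSpectralRadius_eq`). -/

namespace LinearRelaxation

variable {m r : ℕ}

/-! ### Seminorms and their continuity -/

/-- `P` is a seminorm on `ℝ^m`. -/
structure IsSemi (P : (Fin m → ℝ) → ℝ) : Prop where
  smul : ∀ (c : ℝ) (x), P (c • x) = |c| * P x
  add_le : ∀ x y, P (x + y) ≤ P x + P y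

theorem IsNorm.isSemi {N : (Fin m → ℝ) → ℝ} (h : IsNorm N) : IsSemi N := ⟨h.smul, h.add_le⟩

namespace IsSemi

variable {P : (Fin m → ℝ) → ℝ}

theorem zero (h : IsSemi P) : P 0 = 0 := by
  simpa using h.smul 0 0

theorem neg (h : IsSemi P) (x : Fin m → ℝ) : P (-x) = P x := by
  simpa using h.smul (-1) x

theorem nonneg (h : IsSemi P) (x : Fin m → ℝ) : 0 ≤ P x := by
  have h1 := h.add_le x (-x)
  rw [add_neg_cancel, h.zero, h.neg] at h1
  linarith

theorem abs_sub_le (h : IsSemi P) (x y : Fin m → ℝ) : |P x - P y| ≤ P (x - y) := by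
  have h1 := h.add_le (x - y) y
  have h2 := h.add_le (y - x) x
  have h3 := h.neg (x - y)
  rw [neg_sub] at h3
  rw [sub_add_cancel] at h1 h2
  rw [abs_le]
  constructor <;> linarith

theorem le_sum_mul_norm (h : IsSemi P) (x : Fin m → ℝ) :
    P x ≤ (∑ j, P (Pi.single j 1)) * ‖x‖ := by
  have hx : x = ∑ j, x j • (Pi.single j (1 : ℝ) : Fin m → ℝ) := by
    ext k
    simp [Finset.sum_apply, Pi.single_apply]
  calc P x = P (∑ j, x j • (Pi.single j (1 : ℝ) : Fin m → ℝ)) := by rw [← hx]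
    _ ≤ ∑ j, P (x j • (Pi.single j (1 : ℝ) : Fin m → ℝ)) :=
        Finset.le_sum_of_subadditive P h.zero.le h.add_le _ _
    _ ≤ ∑ j, P (Pi.single j 1) * ‖x‖ := by
        refine Finset.sum_le_sum fun j _ => ?_
        rw [h.smul, mul_comm]
        exact mul_le_mul_of_nonneg_left (norm_le_pi_norm x j) (h.nonneg _)
    _ = _ := by rw [Finset.sum_mul]

theorem continuous (h : IsSemi P) : Continuous P := by
  refine continuous_iff_continuousAt.2 fun x => ?_
  rw [ContinuousAt, tendsto_iff_norm_sub_tendsto_zero]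
  refine squeeze_zero (g := fun y => (∑ j, P (Pi.single j 1)) * ‖y - x‖)
    (fun _ => norm_nonneg _) (fun y => (h.abs_sub_le y x).trans (h.le_sum_mul_norm _)) ?_
  have : Continuous fun y : Fin m → ℝ => (∑ j, P (Pi.single j 1)) * ‖y - x‖ := by fun_prop
  simpa using this.tendsto x

end IsSemi

theorem IsNorm.pos {N : (Fin m → ℝ) → ℝ} (h : IsNorm N) {x : Fin m → ℝ} (hx : x ≠ 0) :
    0 < N x :=
  (h.isSemi.nonneg x).lt_of_ne fun h0 => hx ((h.eq_zero_iff x).1 h0.symm)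

theorem IsSemi.isNorm {P : (Fin m → ℝ) → ℝ} (h : IsSemi P) (hp : ∀ x, x ≠ 0 → 0 < P x) :
    IsNorm P where
  eq_zero_iff x := ⟨fun h0 => by_contra fun hx => (hp x hx).ne' h0, fun h0 => h0 ▸ h.zero⟩
  smul := h.smul
  add_le := h.add_le

/-! ### The functional `max_i N (A_i x)` -/

section MaxImage

variable {A : Fin r → Matrix (Fin m) (Fin m) ℝ}

theorem le_maxImage (N : (Fin m → ℝ) → ℝ) (x : Fin m → ℝ) (i : Fin r) :
    N ((A i).mulVec x) ≤ maxImage A N x :=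
  le_ciSup (f := fun i => N ((A i).mulVec x)) (Set.finite_range _).bddAbove i

/-- The common kernel of the `A i` is invariant, and it is not the whole space because some `A i` is
nonzero. -/
theorem maxImage_pos (hA : IsIrreducible A) (hA0 : ∃ i, A i ≠ 0) {N : (Fin m → ℝ) → ℝ}
    (hN : IsNorm N) {x : Fin m → ℝ} (hx : x ≠ 0) : 0 < maxImage A N x := by
  obtain ⟨i₀, hi₀⟩ := hA0
  let V : Submodule ℝ (Fin m → ℝ) := ⨅ i, LinearMap.ker (Matrix.mulVecLin (A i))
  have hV : ∀ y, y ∈ V ↔ ∀ i, (A i).mulVec y = 0 := fun y => by simp [V]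
  have hbot : V = ⊥ := by
    refine (hA V fun i y hy => ?_).resolve_right fun htop => hi₀ ?_
    · rw [(hV y).1 hy i]
      exact V.zero_mem
    · ext a b
      have := congrFun ((hV (Pi.single b 1)).1 (htop ▸ Submodule.mem_top) i₀) a
      simpa using this
  have hxV : x ∉ V := by simpa [hbot] using hx
  rw [hV, not_forall] at hxV
  obtain ⟨i, hi⟩ := hxV
  exact (hN.pos hi).trans_le (le_maxImage N x i)

variable [Nonempty (Fin r)]

theorem maxImage_le {N : (Fin m → ℝ) → ℝ} {x : Fin m → ℝ} {a : ℝ}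
    (h : ∀ i, N ((A i).mulVec x) ≤ a) : maxImage A N x ≤ a :=
  ciSup_le h

theorem exists_eq_maxImage (A : Fin r → Matrix (Fin m) (Fin m) ℝ) (N : (Fin m → ℝ) → ℝ)
    (x : Fin m → ℝ) : ∃ i, N ((A i).mulVec x) = maxImage A N x :=
  exists_eq_ciSup_of_finite (f := fun i => N ((A i).mulVec x))

theorem tendsto_maxImage {α : Type*} {l : Filter α} {P : α → (Fin m → ℝ) → ℝ}
    {Q : (Fin m → ℝ) → ℝ} {x : α → Fin m → ℝ} {y : Fin m → ℝ}
    (h : ∀ i, Tendsto (fun a => P a ((A i).mulVec (x a))) l (𝓝 (Q ((A i).mulVec y)))) :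
    Tendsto (fun a => maxImage A (P a) (x a)) l (𝓝 (maxImage A Q y)) := by
  simp only [maxImage, ← Finset.sup'_univ_eq_ciSup]
  exact Filter.Tendsto.finset_sup'_nhds_apply _ fun i _ => h i

theorem IsSemi.maxImage {N : (Fin m → ℝ) → ℝ} (h : IsSemi N) : IsSemi (maxImage A N) where
  smul c x := by
    simp only [LinearRelaxation.maxImage, Matrix.mulVec_smul, h.smul]
    exact (Real.mul_iSup_of_nonneg (abs_nonneg c) _).symm
  add_le x y := by
    refine maxImage_le fun i => ?_
    rw [Matrix.mulVec_add]
    exact (h.add_le _ _).trans (add_le_add (le_maxImage N x i) (le_maxImage N y i))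

end MaxImage

/-! ### Extreme growth rates of a norm -/

section Growth

variable {A : Fin r → Matrix (Fin m) (Fin m) ℝ} [Nonempty (Fin r)] {N : (Fin m → ℝ) → ℝ}

theorem ratio_normalize (hN : IsNorm N) {x : Fin m → ℝ} (hx : x ≠ 0) :
    maxImage A N (‖x‖⁻¹ • x) / N (‖x‖⁻¹ • x) = maxImage A N x / N x := by
  rw [hN.isSemi.maxImage.smul, hN.smul]
  exact mul_div_mul_left _ _ (abs_ne_zero.2 (inv_ne_zero (norm_ne_zero_iff.2 hx)))

theorem growthRatios_eq_image (hN : IsNorm N) :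
    growthRatios A N = (fun x => maxImage A N x / N x) '' Metric.sphere 0 1 := by
  ext t
  constructor
  · rintro ⟨x, hx, rfl⟩
    refine ⟨‖x‖⁻¹ • x, ?_, ratio_normalize hN hx⟩
    simp [norm_smul, hx]
  · rintro ⟨x, hx, rfl⟩
    exact ⟨x, ne_zero_of_mem_unit_sphere ⟨x, hx⟩, rfl⟩

/-- The ratio is homogeneous of degree 0, so the unit sphere already gives all its values. -/
theorem isCompact_growthRatios (hN : IsNorm N) : IsCompact (growthRatios A N) := by
  rw [growthRatios_eq_image hN]
  refine (isCompact_sphere 0 1).image_of_continuousOn ?_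
  refine hN.isSemi.maxImage.continuous.continuousOn.div hN.isSemi.continuous.continuousOn ?_
  exact fun x hx => (hN.pos (ne_zero_of_mem_unit_sphere ⟨x, hx⟩)).ne'

theorem maxImage_le_of_upperBound (hN : IsNorm N) {p : ℝ} (h : p ∈ upperBounds (growthRatios A N))
    (x : Fin m → ℝ) : maxImage A N x ≤ p * N x := by
  by_cases hx : x = 0
  · rw [hx, hN.isSemi.zero, hN.isSemi.maxImage.zero, mul_zero]
  · exact (div_le_iff₀ (hN.pos hx)).1 (h ⟨x, hx, rfl⟩)

theorem le_maxImage_of_lowerBound (hN : IsNorm N) {p : ℝ} (h : p ∈ lowerBounds (growthRatios A N))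
    (x : Fin m → ℝ) : p * N x ≤ maxImage A N x := by
  by_cases hx : x = 0
  · rw [hx, hN.isSemi.zero, hN.isSemi.maxImage.zero, mul_zero]
  · exact (le_div_iff₀ (hN.pos hx)).1 (h ⟨x, hx, rfl⟩)

theorem exists_maxImage_eq_of_mem (hN : IsNorm N) {p : ℝ} (h : p ∈ growthRatios A N) :
    ∃ x ∈ Metric.sphere (0 : Fin m → ℝ) 1, maxImage A N x = p * N x := by
  rw [growthRatios_eq_image hN] at h
  obtain ⟨x, hx, rfl⟩ := h
  exact ⟨x, hx, (div_mul_cancel₀ _ (hN.pos (ne_zero_of_mem_unit_sphere ⟨x, hx⟩)).ne').symm⟩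

end Growth

/-! ### One relaxation step -/

section Step

variable {A : Fin r → Matrix (Fin m) (Fin m) ℝ} [Nonempty (Fin r)] {N N' : (Fin m → ℝ) → ℝ}
  {l c p : ℝ}

/-- The only second-order term is `maxImage A N` at `A i x`, and the growth bound reduces it to `p *
N (A i x)`. -/
theorem maxImage_step_le (hl : 0 ≤ l) (hc : 0 ≤ c)
    (hN' : ∀ x, N' x = l * N x + c * maxImage A N x) (hp : ∀ x, maxImage A N x ≤ p * N x)
    (hp0 : 0 ≤ p) (x : Fin m → ℝ) :
    maxImage A N' x ≤ l * maxImage A N x + c * (p * maxImage A N x) := by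
  refine maxImage_le fun i => ?_
  rw [hN']
  have h1 := le_maxImage (A := A) N x i
  have h2 := (hp ((A i).mulVec x)).trans (mul_le_mul_of_nonneg_left h1 hp0)
  gcongr

theorem le_maxImage_step (hc : 0 ≤ c)
    (hN' : ∀ x, N' x = l * N x + c * maxImage A N x) (hp : ∀ x, p * N x ≤ maxImage A N x)
    (x : Fin m → ℝ) :
    l * maxImage A N x + c * (p * maxImage A N x) ≤ maxImage A N' x := by
  obtain ⟨i, hi⟩ := exists_eq_maxImage A N x
  refine le_trans ?_ (le_maxImage N' x i)
  rw [hN', ← hi]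
  have := hp ((A i).mulVec x)
  gcongr

theorem maxImage_step_le_mul (hl : 0 ≤ l) (hc : 0 ≤ c)
    (hN' : ∀ x, N' x = l * N x + c * maxImage A N x) (hp : ∀ x, maxImage A N x ≤ p * N x)
    (hp0 : 0 ≤ p) (x : Fin m → ℝ) : maxImage A N' x ≤ p * N' x := by
  have h1 := maxImage_step_le hl hc hN' hp hp0 x
  have h2 := mul_le_mul_of_nonneg_left (hp x) hl
  rw [hN']
  linarith

theorem mul_le_maxImage_step (hl : 0 ≤ l) (hc : 0 ≤ c)
    (hN' : ∀ x, N' x = l * N x + c * maxImage A N x) (hp : ∀ x, p * N x ≤ maxImage A N x)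
    (x : Fin m → ℝ) : p * N' x ≤ maxImage A N' x := by
  have h1 := le_maxImage_step hc hN' hp x
  have h2 := mul_le_mul_of_nonneg_left (hp x) hl
  rw [hN']
  linarith

/-- After the step the deficit `p * N' x - maxImage A N' x` is at least `l` times the deficit before
it. As `l > 0`, extremal vectors are inherited backward in time. -/
theorem maxImage_eq_of_step_eq_upper (hl : 0 < l) (hc : 0 ≤ c)
    (hN' : ∀ x, N' x = l * N x + c * maxImage A N x) (hp : ∀ x, maxImage A N x ≤ p * N x)
    (hp0 : 0 ≤ p) {x : Fin m → ℝ} (hx : maxImage A N' x = p * N' x) :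
    maxImage A N x = p * N x := by
  have h1 := maxImage_step_le hl.le hc hN' hp hp0 x
  rw [hx, hN'] at h1
  exact le_antisymm (hp x) (le_of_mul_le_mul_left (by linarith) hl)

theorem maxImage_eq_of_step_eq_lower (hl : 0 < l) (hc : 0 ≤ c)
    (hN' : ∀ x, N' x = l * N x + c * maxImage A N x) (hp : ∀ x, p * N x ≤ maxImage A N x)
    {x : Fin m → ℝ} (hx : maxImage A N' x = p * N' x) :
    maxImage A N x = p * N x := by
  have h1 := le_maxImage_step hc hN' hp x
  rw [hx, hN'] at h1
  exact le_antisymm (le_of_mul_le_mul_left (by linarith) hl) (hp x)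

theorem IsNorm.step (hl : 0 < l) (hc : 0 ≤ c) (hN : IsNorm N)
    (hN' : ∀ x, N' x = l * N x + c * LinearRelaxation.maxImage A N x) : IsNorm N' := by
  refine IsSemi.isNorm ⟨fun a x => ?_, fun x y => ?_⟩ fun x hx => ?_
  · simp only [hN', hN.smul, (hN.isSemi.maxImage (A := A)).smul]
    ring
  · have h1 := mul_le_mul_of_nonneg_left (hN.add_le x y) hl.le
    have h2 := mul_le_mul_of_nonneg_left ((hN.isSemi.maxImage (A := A)).add_le x y) hc
    simp only [hN']
    linarith
  · rw [hN']
    have h1 := mul_pos hl (hN.pos hx)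
    have h2 := mul_nonneg hc ((hN.isSemi.maxImage (A := A)).nonneg x)
    linarith

end Step

/-! ### Compactness of the class of admissible seminorms -/

/-- Seminorms calibrated by `P e = 1` that grow at most `R` times under the family `A`. -/
structure Admissible (A : Fin r → Matrix (Fin m) (Fin m) ℝ) (e : Fin m → ℝ) (R : ℝ)
    (P : (Fin m → ℝ) → ℝ) : Prop where
  isSemi : IsSemi P
  calibrated : P e = 1
  maxImage_le : ∀ x, maxImage A P x ≤ R * P x

section Admissible

variable {A : Fin r → Matrix (Fin m) (Fin m) ℝ} {e : Fin m → ℝ} {R : ℝ}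

theorem Admissible.apply_mulVec_le {P : (Fin m → ℝ) → ℝ} (hP : Admissible A e R P) (i : Fin r)
    (x : Fin m → ℝ) : P ((A i).mulVec x) ≤ R * P x :=
  (le_maxImage P x i).trans (hP.maxImage_le x)

/-- The kernel of `P` is invariant by the growth bound and misses `e` by calibration, hence is
trivial. -/
theorem Admissible.isNorm (hA : IsIrreducible A) {P : (Fin m → ℝ) → ℝ}
    (hP : Admissible A e R P) : IsNorm P := by
  refine hP.isSemi.isNorm fun x hx => (hP.isSemi.nonneg x).lt_of_ne fun h0 => hx ?_
  let V : Submodule ℝ (Fin m → ℝ) :=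
    { carrier := {y | P y = 0}
      zero_mem' := hP.isSemi.zero
      add_mem' := fun {a b} (ha : P a = 0) (hb : P b = 0) =>
        le_antisymm ((hP.isSemi.add_le a b).trans (by rw [ha, hb, add_zero]))
          (hP.isSemi.nonneg _)
      smul_mem' := fun c a (ha : P a = 0) => by
        simp only [Set.mem_ofPred_eq, hP.isSemi.smul, ha, mul_zero] }
  have hV : ∀ y, y ∈ V ↔ P y = 0 := fun y => Iff.rfl
  have hbot : V = ⊥ := by
    refine (hA V fun i y hy => ?_).resolve_right fun htop => ?_
    · rw [hV] at hy ⊢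
      refine le_antisymm ((hP.apply_mulVec_le i y).trans ?_) (hP.isSemi.nonneg _)
      rw [hy, mul_zero]
    · have he : e ∈ V := htop ▸ Submodule.mem_top
      rw [hV, hP.calibrated] at he
      exact one_ne_zero he
  have hx' : x ∈ V := h0.symm
  rwa [hbot, Submodule.mem_bot] at hx'

/-- The vectors at which the class is bounded form an invariant subspace, and it contains `e`. -/
theorem exists_admissible_le (hA : IsIrreducible A) (he : e ≠ 0) (hR : 0 ≤ R) (x : Fin m → ℝ) :
    ∃ C, ∀ P, Admissible A e R P → P x ≤ C := by
  let V : Submodule ℝ (Fin m → ℝ) :=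
    { carrier := {x | ∃ C, ∀ P, Admissible A e R P → P x ≤ C}
      zero_mem' := ⟨0, fun P hP => hP.isSemi.zero.le⟩
      add_mem' := by
        rintro a b ⟨C, hC⟩ ⟨D, hD⟩
        exact ⟨C + D, fun P hP => (hP.isSemi.add_le a b).trans (add_le_add (hC P hP) (hD P hP))⟩
      smul_mem' := by
        rintro c a ⟨C, hC⟩
        refine ⟨|c| * C, fun P hP => ?_⟩
        rw [hP.isSemi.smul]
        exact mul_le_mul_of_nonneg_left (hC P hP) (abs_nonneg c) }
  have heV : e ∈ V := ⟨1, fun P hP => hP.calibrated.le⟩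
  have htop : V = ⊤ := by
    refine (hA V ?_).resolve_left fun hbot => he ?_
    · rintro i y ⟨C, hC⟩
      exact ⟨R * C, fun P hP =>
        (hP.apply_mulVec_le i y).trans (mul_le_mul_of_nonneg_left (hC P hP) hR)⟩
    · rwa [hbot, Submodule.mem_bot] at heV
  have hx : x ∈ V := htop ▸ Submodule.mem_top
  exact hx

theorem exists_admissible_le_mul_norm (hA : IsIrreducible A) (he : e ≠ 0) (hR : 0 ≤ R) :
    ∃ C, ∀ P, Admissible A e R P → ∀ x, P x ≤ C * ‖x‖ := by
  choose C hC using exists_admissible_le hA he hR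
  refine ⟨∑ j, C (Pi.single j 1), fun P hP x => (hP.isSemi.le_sum_mul_norm x).trans ?_⟩
  gcongr with j
  exact hC _ P hP

variable {α : Type*}

/-- The class has a common Lipschitz constant, so pointwise limits may be taken at moving points. -/
theorem tendsto_apply_of_tendsto (hA : IsIrreducible A) (he : e ≠ 0) (hR : 0 ≤ R)
    {l : Filter α} {P : α → (Fin m → ℝ) → ℝ} {Q : (Fin m → ℝ) → ℝ}
    (hP : ∀ a, Admissible A e R (P a)) (hQ : ∀ x, Tendsto (fun a => P a x) l (𝓝 (Q x)))
    {x : α → Fin m → ℝ} {y : Fin m → ℝ} (hx : Tendsto x l (𝓝 y)) :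
    Tendsto (fun a => P a (x a)) l (𝓝 (Q y)) := by
  obtain ⟨C, hC⟩ := exists_admissible_le_mul_norm hA he hR
  have h1 : Tendsto (fun a => P a (x a) - P a y) l (𝓝 0) := by
    have h2 : Tendsto (fun a => C * ‖x a - y‖) l (𝓝 0) := by
      simpa using (tendsto_iff_norm_sub_tendsto_zero.1 hx).const_mul C
    exact squeeze_zero_norm
      (fun a => ((hP a).isSemi.abs_sub_le _ _).trans (hC _ (hP a) _)) h2
  simpa using h1.add (hQ y)

variable [Nonempty (Fin r)]

theorem Admissible.of_tendsto {l : Filter α} [l.NeBot] {P : α → (Fin m → ℝ) → ℝ}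
    {Q : (Fin m → ℝ) → ℝ} (hP : ∀ a, Admissible A e R (P a))
    (hQ : ∀ x, Tendsto (fun a => P a x) l (𝓝 (Q x))) : Admissible A e R Q where
  isSemi :=
    { smul := fun c x => tendsto_nhds_unique (hQ (c • x)) <| by
        simpa only [(hP _).isSemi.smul] using (hQ x).const_mul |c|
      add_le := fun x y => le_of_tendsto_of_tendsto' (hQ (x + y)) ((hQ x).add (hQ y))
        fun a => (hP a).isSemi.add_le x y }
  calibrated := tendsto_nhds_unique (hQ e) <| by
    simpa only [(hP _).calibrated] using tendsto_const_nhds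
  maxImage_le x := le_of_tendsto_of_tendsto' (tendsto_maxImage fun i => hQ _)
    ((hQ x).const_mul R) fun a => (hP a).maxImage_le x

theorem exists_admissible_limit (hA : IsIrreducible A) (he : e ≠ 0) (hR : 0 ≤ R)
    (U : Ultrafilter α) {P : α → (Fin m → ℝ) → ℝ} (hP : ∀ a, Admissible A e R (P a)) :
    ∃ Q, Admissible A e R Q ∧ ∀ x, Tendsto (fun a => P a x) U (𝓝 (Q x)) := by
  have h : ∀ x, ∃ q, Tendsto (fun a => P a x) U (𝓝 q) := fun x => by
    obtain ⟨C, hC⟩ := exists_admissible_le hA he hR x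
    obtain ⟨q, -, hq⟩ := (isCompact_Icc (a := (0 : ℝ)) (b := C)).ultrafilter_le_nhds
      (U.map fun a => P a x) (by
        simp only [Ultrafilter.coe_map, le_principal_iff, mem_map]
        exact Filter.univ_mem' fun a => ⟨(hP a).isSemi.nonneg x, hC _ (hP a)⟩)
    exact ⟨q, hq⟩
  choose Q hQ using h
  exact ⟨Q, Admissible.of_tendsto hP hQ, hQ⟩

/-- Otherwise a limit of members with values tending to 0 at `x` would be admissible, hence a norm,
yet vanish at `x`. -/
theorem exists_pos_le_admissible (hA : IsIrreducible A) (he : e ≠ 0) (hR : 0 ≤ R)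
    {x : Fin m → ℝ} (hx : x ≠ 0) : ∃ c > 0, ∀ P, Admissible A e R P → c ≤ P x := by
  by_contra! h
  choose! P hP hPx using fun k : ℕ => h (1 / ((k : ℝ) + 1)) Nat.one_div_pos_of_nat
  obtain ⟨Q, hQ, hlim⟩ := exists_admissible_limit hA he hR (hyperfilter ℕ) hP
  refine ((hQ.isNorm hA).pos hx).not_ge ?_
  exact le_of_tendsto_of_tendsto' (hlim x)
    (tendsto_one_div_add_atTop_nhds_zero_nat.mono_left Nat.hyperfilter_le_atTop)
    fun k => (hPx k).le

end Admissible

/-! ### Rigidity of backward orbits -/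

section Rigidity

variable {A : Fin r → Matrix (Fin m) (Fin m) ℝ} [Nonempty (Fin r)] {e : Fin m → ℝ} {R : ℝ}

/-- A backward orbit of the relaxation step with the same two extreme growth rates `q` and `p` at
all times exists only if these rates coincide. -/
theorem growth_rates_eq_of_backward_orbit (hA : IsIrreducible A) (he : e ≠ 0) (hR : 0 ≤ R)
    {M : ℕ → (Fin m → ℝ) → ℝ} {μ : ℕ → ℝ} {lamPlus p q : ℝ} (hM : ∀ j, Admissible A e R (M j))
    (hμ0 : ∀ j, 0 < μ j) (hμ1 : ∀ j, μ j ≤ lamPlus) (hlam : lamPlus < 1)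
    (hstep : ∀ j x, M j x = μ j * M (j + 1) x
      + (1 - μ j) * (maxImage A (M (j + 1)) e)⁻¹ * maxImage A (M (j + 1)) x)
    (hp : ∀ j x, maxImage A (M j) x ≤ p * M j x) (hq : ∀ j x, q * M j x ≤ maxImage A (M j) x)
    (hq0 : 0 < q) (hx : ∃ x, x ≠ 0 ∧ maxImage A (M 0) x = p * M 0 x)
    (hy : ∃ y, y ≠ 0 ∧ maxImage A (M 0) y = q * M 0 y) : p = q := by
  obtain ⟨x, hx0, hx⟩ := hx
  obtain ⟨y, hy0, hy⟩ := hy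
  have hgq : ∀ j, q ≤ maxImage A (M j) e := fun j => by
    simpa only [(hM j).calibrated, mul_one] using hq j e
  have hgp : ∀ j, maxImage A (M j) e ≤ p := fun j => by
    simpa only [(hM j).calibrated, mul_one] using hp j e
  have hg0 : ∀ j, 0 < maxImage A (M j) e := fun j => hq0.trans_le (hgq j)
  have hqp : q ≤ p := (hgq 0).trans (hgp 0)
  have hp0 : 0 < p := hq0.trans_le hqp
  have hc : ∀ j, 0 ≤ (1 - μ j) * (maxImage A (M (j + 1)) e)⁻¹ := fun j =>
    mul_nonneg (by linarith [hμ1 j]) (inv_nonneg.2 (hg0 _).le)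
  have hxj : ∀ j, maxImage A (M j) x = p * M j x := fun j => by
    induction j with
    | zero => exact hx
    | succ j ih =>
      exact maxImage_eq_of_step_eq_upper (hμ0 j) (hc j) (hstep j) (hp (j + 1)) hp0.le ih
  have hyj : ∀ j, maxImage A (M j) y = q * M j y := fun j => by
    induction j with
    | zero => exact hy
    | succ j ih => exact maxImage_eq_of_step_eq_lower (hμ0 j) (hc j) (hstep j) (hq (j + 1)) ih
  by_contra hne
  have hlt : q < p := hqp.lt_of_ne (Ne.symm hne)
  -- With `g = maxImage A (M (j + 1)) e`, a step multiplies the values at `x` and `y` by `μ + (1 -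
  -- μ) p / g` and `μ + (1 - μ) q / g`. The second factor is at most 1 since `q ≤ g`; the factors
  -- differ by at least `δ` since `g ≤ p` and `μ ≤ lamPlus`.
  set δ := (1 - lamPlus) * ((p - q) / p) with hδ
  have hδ0 : 0 < δ := mul_pos (by linarith) (div_pos (by linarith) hp0)
  have hMx : ∀ j, 0 < M j x := fun j => ((hM j).isNorm hA).pos hx0
  have hMy : ∀ j, 0 < M j y := fun j => ((hM j).isNorm hA).pos hy0
  have hratio : ∀ j, (1 + δ) * (M (j + 1) x / M (j + 1) y) ≤ M j x / M j y := fun j => by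
    set g := maxImage A (M (j + 1)) e with hg
    have hgpos : 0 < g := hg0 _
    have hx1 : M j x = (μ j + (1 - μ j) * (p / g)) * M (j + 1) x := by
      rw [hstep, hxj, ← hg]; ring
    have hy1 : M j y = (μ j + (1 - μ j) * (q / g)) * M (j + 1) y := by
      rw [hstep, hyj, ← hg]; ring
    have hμ : 0 ≤ 1 - μ j := by linarith [hμ1 j]
    have hk1 : μ j + (1 - μ j) * (q / g) ≤ 1 := by
      have : q / g ≤ 1 := (div_le_one hgpos).2 (hgq _)
      have := mul_le_mul_of_nonneg_left this hμ
      linarith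
    have hk0 : 0 < μ j + (1 - μ j) * (q / g) :=
      add_pos_of_pos_of_nonneg (hμ0 j) (mul_nonneg hμ (div_pos hq0 hgpos).le)
    have hdiff : δ ≤ (1 - μ j) * ((p - q) / g) := by
      refine mul_le_mul (by linarith [hμ1 j]) ?_ (div_pos (by linarith) hp0).le hμ
      exact div_le_div_of_nonneg_left (by linarith) hgpos (hgp _)
    have hkk : (1 + δ) * (μ j + (1 - μ j) * (q / g)) ≤ μ j + (1 - μ j) * (p / g) := by
      have h1 := mul_le_mul_of_nonneg_left hk1 hδ0.le
      rw [sub_div] at hdiff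
      linarith
    rw [hx1, hy1, mul_div_mul_comm]
    refine mul_le_mul_of_nonneg_right ?_ (div_pos (hMx _) (hMy _)).le
    exact (le_div_iff₀ hk0).2 hkk
  have hpow : ∀ j, (1 + δ) ^ j * (M j x / M j y) ≤ M 0 x / M 0 y := fun j => by
    induction j with
    | zero => simp
    | succ j ih =>
      refine le_trans ?_ ih
      rw [pow_succ, mul_assoc]
      exact mul_le_mul_of_nonneg_left (hratio j) (by positivity)
  -- Compactness keeps `M j x / M j y` above `c / C` for every `j`, against the geometric factor in
  -- `hpow`.
  obtain ⟨c, hc0, hcx⟩ := exists_pos_le_admissible hA he hR hx0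
  obtain ⟨C, hC⟩ := exists_admissible_le hA he hR y
  have hC0 : 0 < C := (hMy 0).trans_le (hC _ (hM 0))
  obtain ⟨J, hJ⟩ := pow_unbounded_of_one_lt ((M 0 x / M 0 y) / (c / C))
    (show 1 < 1 + δ by linarith)
  rw [div_lt_iff₀ (div_pos hc0 hC0)] at hJ
  refine (hJ.trans_le ?_).not_ge (hpow J)
  exact mul_le_mul_of_nonneg_left (div_le_div₀ (hMx J).le (hcx _ (hM J)) (hMy J) (hC _ (hM J)))
    (by positivity)

end Rigidity

/-! ### Monotonicity and limits of the procedure -/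

section Procedure

variable {A : Fin r → Matrix (Fin m) (Fin m) ℝ} {N₀ : (Fin m → ℝ) → ℝ} {e : Fin m → ℝ}
  {lam : ℕ → ℝ} {lamMinus lamPlus : ℝ}

theorem lrNorm_succ (A : Fin r → Matrix (Fin m) (Fin m) ℝ) (N₀ : (Fin m → ℝ) → ℝ)
    (e : Fin m → ℝ) (lam : ℕ → ℝ) (n : ℕ) (x : Fin m → ℝ) :
    lrNorm A N₀ e lam (n + 1) x = lam n * lrNorm A N₀ e lam n x
      + (1 - lam n) * (maxImage A (lrNorm A N₀ e lam n) e)⁻¹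
        * maxImage A (lrNorm A N₀ e lam n) x := rfl

theorem IsNorm.ne_zero_of_eq_one (hN₀ : IsNorm N₀) (he : N₀ e = 1) : e ≠ 0 := by
  rintro rfl
  rw [hN₀.isSemi.zero] at he
  exact zero_ne_one he

variable [Nonempty (Fin r)] (hA : IsIrreducible A) (hA0 : ∃ i, A i ≠ 0) (hN₀ : IsNorm N₀)
  (he : N₀ e = 1) (hlam0 : ∀ n, 0 < lam n) (hlam1 : ∀ n, lam n < 1)

include hN₀ hlam0 hlam1

theorem lrNorm_isNorm (n : ℕ) : IsNorm (lrNorm A N₀ e lam n) := by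
  induction n with
  | zero => exact hN₀
  | succ n ih =>
    refine ih.step (A := A) (hlam0 n) ?_ (lrNorm_succ A N₀ e lam n)
    exact mul_nonneg (by linarith [hlam1 n]) (inv_nonneg.2 (ih.isSemi.maxImage.nonneg e))

include he

theorem isGreatest_rhoPlus (n : ℕ) :
    IsGreatest (growthRatios A (lrNorm A N₀ e lam n)) (rhoPlus A N₀ e lam n) :=
  (isCompact_growthRatios (lrNorm_isNorm hN₀ hlam0 hlam1 n)).isGreatest_sSup
    ⟨_, e, hN₀.ne_zero_of_eq_one he, rfl⟩

theorem isLeast_rhoMinus (n : ℕ) :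
    IsLeast (growthRatios A (lrNorm A N₀ e lam n)) (rhoMinus A N₀ e lam n) :=
  (isCompact_growthRatios (lrNorm_isNorm hN₀ hlam0 hlam1 n)).isLeast_sInf
    ⟨_, e, hN₀.ne_zero_of_eq_one he, rfl⟩

theorem maxImage_lrNorm_le (n : ℕ) (x : Fin m → ℝ) :
    maxImage A (lrNorm A N₀ e lam n) x ≤ rhoPlus A N₀ e lam n * lrNorm A N₀ e lam n x :=
  maxImage_le_of_upperBound (lrNorm_isNorm hN₀ hlam0 hlam1 n)
    (isGreatest_rhoPlus (A := A) hN₀ he hlam0 hlam1 n).2 x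

theorem le_maxImage_lrNorm (n : ℕ) (x : Fin m → ℝ) :
    rhoMinus A N₀ e lam n * lrNorm A N₀ e lam n x ≤ maxImage A (lrNorm A N₀ e lam n) x :=
  le_maxImage_of_lowerBound (lrNorm_isNorm hN₀ hlam0 hlam1 n)
    (isLeast_rhoMinus (A := A) hN₀ he hlam0 hlam1 n).2 x

theorem rhoMinus_le_rhoPlus (n : ℕ) : rhoMinus A N₀ e lam n ≤ rhoPlus A N₀ e lam n :=
  (isLeast_rhoMinus (A := A) hN₀ he hlam0 hlam1 n).2
    (isGreatest_rhoPlus (A := A) hN₀ he hlam0 hlam1 n).1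

include hA hA0

theorem maxImage_lrNorm_pos (n : ℕ) : 0 < maxImage A (lrNorm A N₀ e lam n) e :=
  maxImage_pos hA hA0 (lrNorm_isNorm hN₀ hlam0 hlam1 n) (hN₀.ne_zero_of_eq_one he)

theorem step_coeff_nonneg (n : ℕ) :
    0 ≤ (1 - lam n) * (maxImage A (lrNorm A N₀ e lam n) e)⁻¹ :=
  mul_nonneg (by linarith [hlam1 n])
    (inv_nonneg.2 (maxImage_lrNorm_pos hA hA0 hN₀ he hlam0 hlam1 n).le)

theorem lrNorm_calibrated (n : ℕ) : lrNorm A N₀ e lam n e = 1 := by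
  induction n with
  | zero => exact he
  | succ n ih =>
    rw [lrNorm_succ, ih, mul_assoc,
      inv_mul_cancel₀ (maxImage_lrNorm_pos hA hA0 hN₀ he hlam0 hlam1 n).ne']
    ring

theorem rhoMinus_pos (n : ℕ) : 0 < rhoMinus A N₀ e lam n := by
  obtain ⟨x, hx, h⟩ := (isLeast_rhoMinus (A := A) hN₀ he hlam0 hlam1 n).1
  have hN := lrNorm_isNorm (A := A) (e := e) hN₀ hlam0 hlam1 n
  rw [h]
  exact div_pos (maxImage_pos hA hA0 hN hx) (hN.pos hx)

theorem rhoPlus_nonneg (n : ℕ) : 0 ≤ rhoPlus A N₀ e lam n :=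
  (rhoMinus_pos hA hA0 hN₀ he hlam0 hlam1 n).le.trans
    (rhoMinus_le_rhoPlus hN₀ he hlam0 hlam1 n)

theorem rhoPlus_antitone : Antitone (rhoPlus A N₀ e lam) := by
  refine antitone_nat_of_succ_le fun n => ?_
  obtain ⟨x, hx, h⟩ := (isGreatest_rhoPlus (A := A) hN₀ he hlam0 hlam1 (n + 1)).1
  rw [h, div_le_iff₀ ((lrNorm_isNorm hN₀ hlam0 hlam1 (n + 1)).pos hx)]
  exact maxImage_step_le_mul (hlam0 n).le (step_coeff_nonneg hA hA0 hN₀ he hlam0 hlam1 n)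
    (lrNorm_succ A N₀ e lam n) (maxImage_lrNorm_le hN₀ he hlam0 hlam1 n)
    (rhoPlus_nonneg hA hA0 hN₀ he hlam0 hlam1 n) x

theorem rhoMinus_monotone : Monotone (rhoMinus A N₀ e lam) := by
  refine monotone_nat_of_le_succ fun n => ?_
  obtain ⟨x, hx, h⟩ := (isLeast_rhoMinus (A := A) hN₀ he hlam0 hlam1 (n + 1)).1
  rw [h, le_div_iff₀ ((lrNorm_isNorm hN₀ hlam0 hlam1 (n + 1)).pos hx)]
  exact mul_le_maxImage_step (hlam0 n).le (step_coeff_nonneg hA hA0 hN₀ he hlam0 hlam1 n)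
    (lrNorm_succ A N₀ e lam n) (le_maxImage_lrNorm hN₀ he hlam0 hlam1 n) x

theorem lrNorm_admissible (n : ℕ) :
    Admissible A e (rhoPlus A N₀ e lam 0) (lrNorm A N₀ e lam n) where
  isSemi := (lrNorm_isNorm hN₀ hlam0 hlam1 n).isSemi
  calibrated := lrNorm_calibrated hA hA0 hN₀ he hlam0 hlam1 n
  maxImage_le x := (maxImage_lrNorm_le hN₀ he hlam0 hlam1 n x).trans <|
    mul_le_mul_of_nonneg_right (rhoPlus_antitone hA hA0 hN₀ he hlam0 hlam1 n.zero_le)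
      ((lrNorm_isNorm hN₀ hlam0 hlam1 n).isSemi.nonneg x)

theorem exists_tendsto_rhoPlus : ∃ p, Tendsto (rhoPlus A N₀ e lam) atTop (𝓝 p) :=
  ⟨_, tendsto_atTop_ciInf (rhoPlus_antitone hA hA0 hN₀ he hlam0 hlam1)
    ⟨0, by rintro _ ⟨n, rfl⟩; exact rhoPlus_nonneg hA hA0 hN₀ he hlam0 hlam1 n⟩⟩

theorem exists_tendsto_rhoMinus : ∃ q, 0 < q ∧ Tendsto (rhoMinus A N₀ e lam) atTop (𝓝 q) := by
  have hb : BddAbove (Set.range (rhoMinus A N₀ e lam)) := by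
    refine ⟨rhoPlus A N₀ e lam 0, ?_⟩
    rintro _ ⟨n, rfl⟩
    exact (rhoMinus_le_rhoPlus hN₀ he hlam0 hlam1 n).trans
      (rhoPlus_antitone hA hA0 hN₀ he hlam0 hlam1 n.zero_le)
  exact ⟨_, (rhoMinus_pos hA hA0 hN₀ he hlam0 hlam1 0).trans_le (le_ciSup hb 0),
    tendsto_atTop_ciSup (rhoMinus_monotone hA hA0 hN₀ he hlam0 hlam1) hb⟩

/-- A growth rate attained along the procedure is attained, in the limit, by a limit norm. -/
theorem exists_maxImage_eq_limit (U : Ultrafilter ℕ) {M : (Fin m → ℝ) → ℝ}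
    (hM : ∀ x, Tendsto (fun n => lrNorm A N₀ e lam n x) U (𝓝 (M x))) {t : ℕ → ℝ} {s : ℝ}
    (ht : ∀ n, t n ∈ growthRatios A (lrNorm A N₀ e lam n)) (hs : Tendsto t U (𝓝 s)) :
    ∃ x, x ≠ 0 ∧ maxImage A M x = s * M x := by
  have hR := rhoPlus_nonneg hA hA0 hN₀ he hlam0 hlam1 0
  have hadm := lrNorm_admissible hA hA0 hN₀ he hlam0 hlam1
  have he0 := hN₀.ne_zero_of_eq_one he
  choose x hx hxt using fun n =>
    exists_maxImage_eq_of_mem (lrNorm_isNorm hN₀ hlam0 hlam1 n) (ht n)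
  obtain ⟨z, hz, hlim⟩ := (isCompact_sphere (0 : Fin m → ℝ) 1).ultrafilter_le_nhds (U.map x) (by
    simp only [Ultrafilter.coe_map, le_principal_iff, mem_map]
    exact Filter.univ_mem' hx)
  have hlim' : Tendsto x U (𝓝 z) := hlim
  refine ⟨z, ne_zero_of_mem_unit_sphere ⟨z, hz⟩, ?_⟩
  have h1 : Tendsto (fun n => maxImage A (lrNorm A N₀ e lam n) (x n)) U (𝓝 (maxImage A M z)) :=
    tendsto_maxImage fun i => tendsto_apply_of_tendsto hA he0 hR hadm hM
      (((Continuous.matrix_mulVec continuous_const continuous_id).tendsto z).comp hlim')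
  have h2 := hs.mul (tendsto_apply_of_tendsto hA he0 hR hadm hM hlim')
  refine tendsto_nhds_unique h1 (h2.congr fun n => (hxt n).symm)

theorem exists_limit_of_lrNorm (hlam : ∀ n, lam n ∈ Set.Icc lamMinus lamPlus)
    (hlamMinus : 0 < lamMinus) (hlamPlus : lamPlus < 1) (U : Ultrafilter ℕ)
    (hU : (U : Filter ℕ) ≤ atTop) {p q : ℝ} (hp : Tendsto (rhoPlus A N₀ e lam) atTop (𝓝 p))
    (hq : Tendsto (rhoMinus A N₀ e lam) atTop (𝓝 q)) (hq0 : 0 < q) :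
    p = q ∧ ∃ B, Admissible A e (rhoPlus A N₀ e lam 0) B ∧ (∀ x, q * B x = maxImage A B x) ∧
      ∀ x, Tendsto (fun n => lrNorm A N₀ e lam n x) U (𝓝 (B x)) := by
  have hR := rhoPlus_nonneg hA hA0 hN₀ he hlam0 hlam1 0
  have hadm := lrNorm_admissible hA hA0 hN₀ he hlam0 hlam1
  have he0 := hN₀.ne_zero_of_eq_one he
  -- Subtraction is truncated, so `lrNorm` at `n - j` makes sense for every `n`. One ultrafilter
  -- serves all shifts, which links the limits by the relaxation step.
  choose M hM hMlim using fun j : ℕ =>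
    exists_admissible_limit hA he0 hR U (P := fun n => lrNorm A N₀ e lam (n - j)) fun n => hadm _
  have hsub : ∀ j : ℕ, Tendsto (fun n => n - j) U atTop := fun j =>
    (tendsto_sub_atTop_nat j).mono_left hU
  have hμ : ∀ j : ℕ, ∃ μ ∈ Set.Icc lamMinus lamPlus, Tendsto (fun n => lam (n - j)) U (𝓝 μ) :=
    fun j => isCompact_Icc.ultrafilter_le_nhds (U.map fun n => lam (n - j)) (by
      simp only [Ultrafilter.coe_map, le_principal_iff, mem_map]
      exact Filter.univ_mem' fun n => hlam _)
  choose μ hμ hμlim using hμ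
  have hT : ∀ j x, Tendsto (fun n => maxImage A (lrNorm A N₀ e lam (n - j)) x) U
      (𝓝 (maxImage A (M j) x)) := fun j x => tendsto_maxImage fun i => hMlim j _
  have hMp : ∀ j x, maxImage A (M j) x ≤ p * M j x := fun j x =>
    le_of_tendsto_of_tendsto' (hT j x) ((hp.comp (hsub j)).mul (hMlim j x))
      fun n => maxImage_lrNorm_le hN₀ he hlam0 hlam1 _ x
  have hMq : ∀ j x, q * M j x ≤ maxImage A (M j) x := fun j x =>
    le_of_tendsto_of_tendsto' ((hq.comp (hsub j)).mul (hMlim j x)) (hT j x)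
      fun n => le_maxImage_lrNorm hN₀ he hlam0 hlam1 _ x
  have hg : ∀ j, 0 < maxImage A (M j) e := fun j => by
    have := hMq j e
    rw [(hM j).calibrated, mul_one] at this
    exact hq0.trans_le this
  have hstep : ∀ j x, M j x = μ (j + 1) * M (j + 1) x
      + (1 - μ (j + 1)) * (maxImage A (M (j + 1)) e)⁻¹ * maxImage A (M (j + 1)) x := fun j x => by
    refine tendsto_nhds_unique (hMlim j x) (Tendsto.congr' ?_
      (((hμlim (j + 1)).mul (hMlim (j + 1) x)).add
        (((tendsto_const_nhds.sub (hμlim (j + 1))).mul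
          ((hT (j + 1) e).inv₀ (hg (j + 1)).ne')).mul (hT (j + 1) x))))
    -- The recursion between the shifts `j + 1` and `j` needs `n ≥ j + 1`, which holds eventually
    -- along `U`.
    filter_upwards [hU (eventually_ge_atTop (j + 1))] with n hn
    rw [← lrNorm_succ, show n - (j + 1) + 1 = n - j by have : j + 1 ≤ n := hn; omega]
  have hM0 : ∀ x, Tendsto (fun n => lrNorm A N₀ e lam n x) U (𝓝 (M 0 x)) := hMlim 0
  have hpq : p = q := growth_rates_eq_of_backward_orbit hA he0 hR hM
    (fun j => hlamMinus.trans_le (hμ (j + 1)).1) (fun j => (hμ (j + 1)).2) hlamPlus hstep hMp hMq hq0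
    (exists_maxImage_eq_limit hA hA0 hN₀ he hlam0 hlam1 U hM0
      (fun n => (isGreatest_rhoPlus (A := A) hN₀ he hlam0 hlam1 n).1) (hp.mono_left hU))
    (exists_maxImage_eq_limit hA hA0 hN₀ he hlam0 hlam1 U hM0
      (fun n => (isLeast_rhoMinus (A := A) hN₀ he hlam0 hlam1 n).1) (hq.mono_left hU))
  exact ⟨hpq, M 0, hM 0, fun x => le_antisymm (hMq 0 x) (hpq ▸ hMp 0 x), hM0⟩

/-! ### From ultrafilter convergence to convergence of the whole sequence -/

omit hA hA0 he in
/-- The step of the procedure does not increase the eccentricity with respect to a function `B`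
with `s B = max_i B (A_i ·)`. -/
theorem lrNorm_eccentricity_le {B : (Fin m → ℝ) → ℝ} {s : ℝ} (hs : 0 ≤ s)
    (hB : ∀ x, s * B x = maxImage A B x) {a b : ℝ} (hb : 0 ≤ b) {n₀ : ℕ}
    (hlow : ∀ x, a * B x ≤ lrNorm A N₀ e lam n₀ x)
    (hup : ∀ x, lrNorm A N₀ e lam n₀ x ≤ b * B x) (n : ℕ) (hn : n₀ ≤ n) :
    ∃ κ > 0, (∀ x, κ * a * B x ≤ lrNorm A N₀ e lam n x) ∧
      ∀ x, lrNorm A N₀ e lam n x ≤ κ * b * B x := by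
  induction n, hn using Nat.le_induction with
  | base => exact ⟨1, one_pos, by simpa using hlow, by simpa using hup⟩
  | succ n _ ih =>
    obtain ⟨κ, hκ, h1, h2⟩ := ih
    set N := lrNorm A N₀ e lam n with hN
    set c := (1 - lam n) * (maxImage A N e)⁻¹ with hc
    have hc0 : 0 ≤ c := mul_nonneg (by linarith [hlam1 n])
      (inv_nonneg.2 ((lrNorm_isNorm hN₀ hlam0 hlam1 n).isSemi.maxImage.nonneg e))
    have hstep : ∀ x, lrNorm A N₀ e lam (n + 1) x = lam n * N x + c * maxImage A N x :=
      lrNorm_succ A N₀ e lam n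
    -- On a multiple of `B` the step acts as multiplication by `lam n + c * s`, so both bounds scale
    -- alike and their ratio is kept.
    refine ⟨κ * (lam n + c * s), mul_pos hκ (add_pos_of_pos_of_nonneg (hlam0 n)
      (mul_nonneg hc0 hs)), fun x => ?_, fun x => ?_⟩
    · have h3 : κ * a * (s * B x) ≤ maxImage A N x := by
        obtain ⟨i, hi⟩ := exists_eq_maxImage A B x
        rw [hB, ← hi]
        exact (h1 _).trans (le_maxImage N x i)
      have h4 := mul_le_mul_of_nonneg_left h3 hc0
      have h5 := mul_le_mul_of_nonneg_left (h1 x) (hlam0 n).le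
      rw [hstep]
      linarith
    · have h3 : maxImage A N x ≤ κ * b * (s * B x) := by
        refine maxImage_le fun i => (h2 _).trans ?_
        rw [hB]
        exact mul_le_mul_of_nonneg_left (le_maxImage B x i) (by positivity)
      have h4 := mul_le_mul_of_nonneg_left h3 hc0
      have h5 := mul_le_mul_of_nonneg_left (h2 x) (hlam0 n).le
      rw [hstep]
      linarith

theorem eventually_abs_lrNorm_sub_le {U : Ultrafilter ℕ} {B : (Fin m → ℝ) → ℝ}
    (hB : Admissible A e (rhoPlus A N₀ e lam 0) B)
    (hlim : ∀ x, Tendsto (fun n => lrNorm A N₀ e lam n x) U (𝓝 (B x))) {ε : ℝ} (hε : 0 < ε) :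
    ∀ᶠ n in U, ∀ x, |lrNorm A N₀ e lam n x - B x| ≤ ε * B x := by
  have hBn := hB.isNorm hA
  have hBc := hBn.isSemi.continuous
  have hR := rhoPlus_nonneg hA hA0 hN₀ he hlam0 hlam1 0
  have hadm := lrNorm_admissible hA hA0 hN₀ he hlam0 hlam1
  have he0 := hN₀.ne_zero_of_eq_one he
  suffices h : ∀ᶠ n in U, ∀ x ∈ Metric.sphere (0 : Fin m → ℝ) 1,
      |lrNorm A N₀ e lam n x - B x| ≤ ε * B x by
    filter_upwards [h] with n hn x
    by_cases hx : x = 0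
    · simp [hx, hBn.isSemi.zero, (hadm n).isSemi.zero]
    · have h1 := hn (‖x‖⁻¹ • x) (by simp [norm_smul, hx])
      have h2 : 0 < |‖x‖⁻¹| := abs_pos.2 (inv_ne_zero (norm_ne_zero_iff.2 hx))
      rw [hBn.smul, (hadm n).isSemi.smul, ← mul_sub, abs_mul, abs_abs, mul_left_comm] at h1
      exact le_of_mul_le_mul_left h1 h2
  by_contra hcon
  rw [← Ultrafilter.eventually_not] at hcon
  have hne : ∀ n, ∃ x ∈ Metric.sphere (0 : Fin m → ℝ) 1,
      (¬ ∀ y ∈ Metric.sphere (0 : Fin m → ℝ) 1, |lrNorm A N₀ e lam n y - B y| ≤ ε * B y) →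
        ε * B x < |lrNorm A N₀ e lam n x - B x| := fun n => by
    by_cases h : ∀ y ∈ Metric.sphere (0 : Fin m → ℝ) 1, |lrNorm A N₀ e lam n y - B y| ≤ ε * B y
    · exact ⟨‖e‖⁻¹ • e, by simp [norm_smul, he0], fun h' => absurd h h'⟩
    · have h' := h
      push Not at h'
      obtain ⟨x, hx, hlt⟩ := h'
      exact ⟨x, hx, fun _ => hlt⟩
  choose x hx hlt using hne
  obtain ⟨z, hz, hxz⟩ := (isCompact_sphere (0 : Fin m → ℝ) 1).ultrafilter_le_nhds (U.map x) (by
    simp only [Ultrafilter.coe_map, le_principal_iff, mem_map]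
    exact Filter.univ_mem' hx)
  have hxz' : Tendsto x U (𝓝 z) := hxz
  have hBz := (hBc.tendsto z).comp hxz'
  have h1 := ((tendsto_apply_of_tendsto hA he0 hR hadm hlim hxz').sub hBz).abs
  rw [sub_self, abs_zero] at h1
  have h2 : ε * B z ≤ 0 := le_of_tendsto_of_tendsto (hBz.const_mul ε) h1 <| by
    filter_upwards [hcon] with n hn
    exact (hlt n hn).le
  exact h2.not_gt (mul_pos hε (hBn.pos (ne_zero_of_mem_unit_sphere ⟨z, hz⟩)))

theorem eventually_abs_lrNorm_sub_le_atTop {U : Ultrafilter ℕ} {B : (Fin m → ℝ) → ℝ} {s : ℝ}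
    (hs : 0 ≤ s) (hB : Admissible A e (rhoPlus A N₀ e lam 0) B)
    (hBs : ∀ x, s * B x = maxImage A B x)
    (hlim : ∀ x, Tendsto (fun n => lrNorm A N₀ e lam n x) U (𝓝 (B x))) {ε : ℝ} (hε : 0 < ε) :
    ∀ᶠ n in atTop, ∀ x, |lrNorm A N₀ e lam n x - B x| ≤ ε * B x := by
  -- `δ = ε / (2 + ε)` solves `2δ = ε(1 - δ)`. Calibration at `e` gives `κ(1 - δ) ≤ 1 ≤ κ(1 + δ)`,
  -- so both of these factors are within `2κδ ≤ ε` of 1.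
  obtain ⟨δ, hδ0, hδ1, hδ⟩ : ∃ δ : ℝ, 0 < δ ∧ δ < 1 ∧ 2 * δ ≤ ε * (1 - δ) := by
    refine ⟨ε / (2 + ε), by positivity, by rw [div_lt_one (by positivity)]; linarith, ?_⟩
    rw [show ε * (1 - ε / (2 + ε)) = 2 * (ε / (2 + ε)) by field_simp; ring]
  obtain ⟨n₀, hn₀⟩ :=
    (eventually_abs_lrNorm_sub_le hA hA0 hN₀ he hlam0 hlam1 hB hlim hδ0).exists
  filter_upwards [eventually_ge_atTop n₀] with n hn x
  obtain ⟨κ, hκ, h1, h2⟩ := lrNorm_eccentricity_le (e := e) hN₀ hlam0 hlam1 hs hBs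
    (a := 1 - δ) (b := 1 + δ) (by linarith)
    (fun x => by linarith [(abs_le.1 (hn₀ x)).1]) (fun x => by linarith [(abs_le.1 (hn₀ x)).2]) n hn
  have he1 := h1 e
  have he2 := h2 e
  rw [lrNorm_calibrated hA hA0 hN₀ he hlam0 hlam1, hB.calibrated, mul_one] at he1 he2
  have hκ2 : κ * (2 * δ) ≤ κ * (ε * (1 - δ)) := mul_le_mul_of_nonneg_left hδ hκ.le
  have hκ3 : ε * (κ * (1 - δ)) ≤ ε * 1 := mul_le_mul_of_nonneg_left he1 hε.le
  have hx0 := hB.isSemi.nonneg x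
  have hlow : (1 - ε) * B x ≤ κ * (1 - δ) * B x :=
    mul_le_mul_of_nonneg_right (by linarith) hx0
  have hup : κ * (1 + δ) * B x ≤ (1 + ε) * B x :=
    mul_le_mul_of_nonneg_right (by linarith) hx0
  rw [abs_le]
  constructor <;> linarith [h1 x, h2 x]

end Procedure

/-! ### Barabanov norms and the joint spectral radius -/

section JointSpectralRadius

variable {A : Fin r → Matrix (Fin m) (Fin m) ℝ} {N B : (Fin m → ℝ) → ℝ} {s : ℝ}

theorem IsNorm.exists_le_mul (hN : IsNorm N) (hB : IsSemi B) : ∃ C > 0, ∀ x, B x ≤ C * N x := by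
  have hcont : ContinuousOn (fun x => B x / N x) (Metric.sphere 0 1) :=
    hB.continuous.continuousOn.div hN.isSemi.continuous.continuousOn
      fun x hx => (hN.pos (ne_zero_of_mem_unit_sphere ⟨x, hx⟩)).ne'
  obtain ⟨C, hC⟩ := (isCompact_sphere (0 : Fin m → ℝ) 1).bddAbove_image hcont
  refine ⟨max C 1, lt_max_of_lt_right one_pos, fun x => ?_⟩
  by_cases hx : x = 0
  · simp [hx, hB.zero, hN.isSemi.zero]
  · have h1 := hC ⟨‖x‖⁻¹ • x, by simp [norm_smul, hx], rfl⟩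
    simp only [hB.smul, hN.smul] at h1
    rw [mul_div_mul_left _ _ (abs_ne_zero.2 (inv_ne_zero (norm_ne_zero_iff.2 hx))),
      div_le_iff₀ (hN.pos hx)] at h1
    exact h1.trans (mul_le_mul_of_nonneg_right (le_max_left _ _) (hN.isSemi.nonneg x))

theorem IsBarabanovNorm.prod_mulVec_le (hB : IsBarabanovNorm A s B) (hs : 0 ≤ s) {k : ℕ}
    (w : Fin k → Fin r) (x : Fin m → ℝ) :
    B ((List.ofFn fun j => A (w j)).prod.mulVec x) ≤ s ^ k * B x := by
  induction k with
  | zero => simp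
  | succ k ih =>
    rw [List.ofFn_succ, List.prod_cons, ← Matrix.mulVec_mulVec, pow_succ', mul_assoc]
    refine (le_maxImage B _ (w 0)).trans ?_
    rw [← hB.2]
    exact mul_le_mul_of_nonneg_left (ih fun j => w j.succ) hs

theorem IsBarabanovNorm.exists_prod_mulVec_eq [Nonempty (Fin r)] (hB : IsBarabanovNorm A s B)
    (k : ℕ) (x : Fin m → ℝ) :
    ∃ w : Fin k → Fin r, B ((List.ofFn fun j => A (w j)).prod.mulVec x) = s ^ k * B x := by
  induction k with
  | zero => exact ⟨Fin.elim0, by simp⟩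
  | succ k ih =>
    obtain ⟨w, hw⟩ := ih
    obtain ⟨i, hi⟩ := exists_eq_maxImage A B ((List.ofFn fun j => A (w j)).prod.mulVec x)
    -- The matrix chosen last acts last, so it is the leftmost factor, at the head of the list.
    refine ⟨Fin.cons i w, ?_⟩
    rw [List.ofFn_succ, List.prod_cons, ← Matrix.mulVec_mulVec]
    simp only [Fin.cons_zero, Fin.cons_succ]
    rw [hi, ← hB.2, hw, pow_succ', mul_assoc]

theorem tendsto_const_mul_pow_rpow {c : ℝ} (hc : 0 < c) (hs : 0 ≤ s) :
    Tendsto (fun k : ℕ => (c * s ^ k) ^ (1 / (k : ℝ))) atTop (𝓝 s) := by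
  have h1 : Tendsto (fun k : ℕ => c ^ (1 / (k : ℝ)) * s) atTop (𝓝 s) := by
    have h2 : Tendsto (fun k : ℕ => c ^ (1 / (k : ℝ))) atTop (𝓝 (c ^ (0 : ℝ))) :=
      (Real.continuous_const_rpow hc.ne').continuousAt.tendsto.comp
        tendsto_one_div_atTop_nhds_zero_nat
    simpa using h2.mul_const s
  refine h1.congr' ?_
  filter_upwards [eventually_ne_atTop 0] with k hk
  rw [Real.mul_rpow hc.le (pow_nonneg hs k), one_div, Real.pow_rpow_inv_natCast hs hk]

/-- The joint spectral radius, computed with any norm, is the growth rate of any Barabanov norm. -/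
theorem IsBarabanovNorm.jointSpectralRadius_eq [Nonempty (Fin r)] (hB : IsBarabanovNorm A s B)
    (hs : 0 ≤ s) (hN : IsNorm N) {e : Fin m → ℝ} (he : e ≠ 0) : jointSpectralRadius N A = s := by
  obtain ⟨C, hC0, hC⟩ := hN.exists_le_mul hB.1.isSemi
  obtain ⟨D, hD0, hD⟩ := hB.1.exists_le_mul hN.isSemi
  have hle : ∀ (k : ℕ) (w : Fin k → Fin r) (x : Fin m → ℝ), N x = 1 →
      N ((List.ofFn fun j => A (w j)).prod.mulVec x) ≤ D * C * s ^ k := fun k w x hx => by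
    have h1 := mul_le_mul_of_nonneg_left (hC x) (pow_nonneg hs k)
    have h2 := mul_le_mul_of_nonneg_left ((hB.prod_mulVec_le hs w x).trans h1) hD0.le
    rw [hx] at h2
    have h3 := hD ((List.ofFn fun j => A (w j)).prod.mulVec x)
    linarith
  have hop : ∀ (k : ℕ) (w : Fin k → Fin r),
      opNorm N (List.ofFn fun j => A (w j)).prod ≤ D * C * s ^ k := fun k w =>
    Real.sSup_le (by rintro t ⟨x, hx, rfl⟩; exact hle k w x hx) (by positivity)
  have hmax : ∀ k, maxProdNorm N A k ≤ D * C * s ^ k := fun k => ciSup_le (hop k)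
  -- Some product stretches `B` at the normalised `e` by exactly `s ^ k`; passing from `N` to `B`
  -- and back costs the factor `D * C`.
  have hlow : ∀ k, (D * C)⁻¹ * s ^ k ≤ maxProdNorm N A k := fun k => by
    have hNe := hN.pos he
    have hx1 : N ((N e)⁻¹ • e) = 1 := by
      rw [hN.smul, abs_of_pos (inv_pos.2 hNe), inv_mul_cancel₀ hNe.ne']
    obtain ⟨w, hw⟩ := hB.exists_prod_mulVec_eq k ((N e)⁻¹ • e)
    have h1 : N ((List.ofFn fun j => A (w j)).prod.mulVec ((N e)⁻¹ • e)) ≤ maxProdNorm N A k :=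
      le_trans (b := opNorm N (List.ofFn fun j => A (w j)).prod)
        (le_csSup ⟨D * C * s ^ k, by rintro t ⟨x, hx, rfl⟩; exact hle k w x hx⟩ ⟨_, hx1, rfl⟩)
        (le_ciSup (f := fun w : Fin k → Fin r => opNorm N (List.ofFn fun j => A (w j)).prod)
          (Set.finite_range _).bddAbove w)
    refine le_trans ?_ h1
    have h2 := hC ((List.ofFn fun j => A (w j)).prod.mulVec ((N e)⁻¹ • e))
    have h3 := hD ((N e)⁻¹ • e)
    rw [hw] at h2
    rw [hx1] at h3
    rw [inv_mul_le_iff₀ (by positivity), mul_assoc]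
    calc s ^ k = s ^ k * 1 := (mul_one _).symm
      _ ≤ s ^ k * (D * B ((N e)⁻¹ • e)) := mul_le_mul_of_nonneg_left h3 (pow_nonneg hs k)
      _ = D * (s ^ k * B ((N e)⁻¹ • e)) := by ring
      _ ≤ _ := mul_le_mul_of_nonneg_left h2 hD0.le
  refine (tendsto_of_tendsto_of_tendsto_of_le_of_le
    (tendsto_const_mul_pow_rpow (inv_pos.2 (mul_pos hD0 hC0)) hs)
    (tendsto_const_mul_pow_rpow (mul_pos hD0 hC0) hs) (fun k => ?_) fun k => ?_).limsup_eq
  · exact Real.rpow_le_rpow (by positivity) (hlow k) (by positivity)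
  · exact Real.rpow_le_rpow (le_trans (by positivity) (hlow k)) (hmax k) (by positivity)

end JointSpectralRadius

end LinearRelaxation

/-! ### Proof of the theorem -/

open LinearRelaxation

theorem mainTheorem1 {m r : ℕ} (A : Fin r → Matrix (Fin m) (Fin m) ℝ)
    (hA : LinearRelaxation.IsIrreducible A) (hA0 : ∃ i, A i ≠ 0)
    (N₀ : (Fin m → ℝ) → ℝ) (hN₀ : LinearRelaxation.IsNorm N₀)
    (e : Fin m → ℝ) (he : N₀ e = 1)
    (lamMinus lamPlus : ℝ) (hlamMinus : 0 < lamMinus) (hlamPlus : lamPlus < 1)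
    (lam : ℕ → ℝ) (hlam : ∀ n, lam n ∈ Set.Icc lamMinus lamPlus)
    (N : (Fin m → ℝ) → ℝ) (hN : LinearRelaxation.IsNorm N) :
    -- the procedure is well defined: `‖·‖_n` are norms, `γ_n > 0`, and the maximum and the
    -- minimum that define `ρ⁺_n` and `ρ⁻_n` are attained
    (∀ n, LinearRelaxation.IsNorm (LinearRelaxation.lrNorm A N₀ e lam n) ∧
      0 < LinearRelaxation.maxImage A (LinearRelaxation.lrNorm A N₀ e lam n) e ∧
      IsGreatest (LinearRelaxation.growthRatios A (LinearRelaxation.lrNorm A N₀ e lam n))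
        (LinearRelaxation.rhoPlus A N₀ e lam n) ∧
      IsLeast (LinearRelaxation.growthRatios A (LinearRelaxation.lrNorm A N₀ e lam n))
        (LinearRelaxation.rhoMinus A N₀ e lam n)) ∧
    Tendsto (LinearRelaxation.rhoPlus A N₀ e lam) atTop
      (𝓝 (LinearRelaxation.jointSpectralRadius N A)) ∧
    Tendsto (LinearRelaxation.rhoMinus A N₀ e lam) atTop
      (𝓝 (LinearRelaxation.jointSpectralRadius N A)) ∧
    ∃ Nstar : (Fin m → ℝ) → ℝ,
      LinearRelaxation.IsBarabanovNorm A (LinearRelaxation.jointSpectralRadius N A) Nstar ∧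
      ∀ S : Set (Fin m → ℝ), Bornology.IsBounded S →
        TendstoUniformlyOn (LinearRelaxation.lrNorm A N₀ e lam) Nstar atTop S := by
  have hne : Nonempty (Fin r) := hA0.nonempty
  have hlam0 : ∀ n, 0 < lam n := fun n => hlamMinus.trans_le (hlam n).1
  have hlam1 : ∀ n, lam n < 1 := fun n => (hlam n).2.trans_lt hlamPlus
  have he0 := hN₀.ne_zero_of_eq_one he
  obtain ⟨p, hp⟩ := exists_tendsto_rhoPlus hA hA0 hN₀ he hlam0 hlam1
  obtain ⟨q, hq0, hq⟩ := exists_tendsto_rhoMinus hA hA0 hN₀ he hlam0 hlam1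
  obtain ⟨rfl, B, hB, hBq, hlim⟩ := exists_limit_of_lrNorm hA hA0 hN₀ he hlam0 hlam1 hlam
    hlamMinus hlamPlus (hyperfilter ℕ) Nat.hyperfilter_le_atTop hp hq hq0
  have hBar : IsBarabanovNorm A p B := ⟨hB.isNorm hA, hBq⟩
  rw [hBar.jointSpectralRadius_eq hq0.le hN he0]
  refine ⟨fun n => ⟨lrNorm_isNorm hN₀ hlam0 hlam1 n,
    maxImage_lrNorm_pos hA hA0 hN₀ he hlam0 hlam1 n,
    isGreatest_rhoPlus hN₀ he hlam0 hlam1 n,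
    isLeast_rhoMinus hN₀ he hlam0 hlam1 n⟩, hp, hq, B, hBar, fun S hS => ?_⟩
  obtain ⟨K, hK0, hK⟩ := hS.exists_pos_norm_le
  set C := ∑ j, B (Pi.single j 1) with hC
  have hC0 : 0 ≤ C := Finset.sum_nonneg fun j _ => hB.isSemi.nonneg _
  -- `C * K` bounds `B` on `S`; the added 1 makes the divisor positive and the final inequality
  -- strict.
  have hCK : 0 < C * K + 1 := by positivity
  rw [Metric.tendstoUniformlyOn_iff]
  intro ε hε
  filter_upwards [eventually_abs_lrNorm_sub_le_atTop hA hA0 hN₀ he hlam0 hlam1 hq0.le hB hBq hlim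
    (div_pos hε hCK)] with n hn x hx
  rw [dist_comm, Real.dist_eq]
  refine (hn x).trans_lt ?_
  rw [div_mul_eq_mul_div, div_lt_iff₀ hCK]
  refine mul_lt_mul_of_pos_left ?_ hε
  have h1 := mul_le_mul_of_nonneg_left (hK x hx) hC0
  linarith [hB.isSemi.le_sum_mul_norm x]
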